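/- Let $N\ge 2$ be an integer and $\Lambda=\{1,\dots,N\}$. Let $J:\{1,2,\dots\}\to\mathbb R$ be positive and decreasing (non-increasing suffices), and let $h$ satisfy $$0<h<\sum_{n=1}^{N-1}J(n).$$ For $\sigma\in\Omega_\Lambda=\{-1,1\}^\Lambda$ put $$H(\sigma)=-\sum_{1\le i<j\le N}J(j-i)\,\sigma_i\sigma_j-h\sum_{i=1}^N\sigma_i .$$ Let $\mathbf{-1}$ and $\mathbf{+1}$ be the constant configurations. For $0\le k\le N$ let $L^{(k)}$ be the configuration with $L^{(k)}_i=+1$ for $i\le k$ and $L^{(k)}_i=-1$ for $i>k$ (its mirror image, with the $k$ plus spins on the right, has the same energy). Set $$\Gamma=\max_{0\le k\le N}H(L^{(k)})-H(\mathbf{-1}).$$ For $\beta>0$ let $(X(t))_{t=0,1,2,\dots}$ be the discrete-time Metropolis chain on $\Omega_\Lambda$ started at $X(0)=\mathbf{-1}$, with transition probabilities $$p(\sigma,\eta)=\frac1N\,e^{-\beta\max\{H(\eta)-H(\sigma),\,0\}}$$ if $\sigma$ and $\eta$ differ at exactly one site, $p(\sigma,\eta)=0$ if they differ at two or more sites,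 and $p(\sigma,\sigma)=1-\sum_{\eta\ne\sigma}p(\sigma,\eta)$. Let $\tau=\inf\{t>0: X(t)=\mathbf{+1}\}$. Then: 1. for every $\varepsilon>0$, $$\lim_{\beta\to\infty}\mathbb P\left(e^{\beta(\Gamma-\varepsilon)}<\tau<e^{\beta(\Gamma+\varepsilon)}\right)=1;$$ 2. $\mathbb E(\tau)<\infty$ for every $\beta>0$, and $$\lim_{\beta\to\infty}\frac1\beta\log\mathbb E(\tau)=\Gamma .$$ -/

import Mathlib

open MeasureTheory ProbabilityTheory Filter Topology
open scoped NNReal ENNReal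

namespace LongRangeIsing

/-- Spin configurations on an interval of `N` sites. The site `i : Fin N` stands for the lattice
point `i + 1` of `{1, …, N}`, and the units `ℤˣ = {-1, 1}` are the spin values. -/
abbrev Config (N : ℕ) : Type := Fin N → ℤˣ

instance : MeasurableSingletonClass ℤˣ :=
  ⟨fun u => ⟨{(u : ℤ)}, MeasurableSet.of_discrete, by
    ext v
    simp only [Set.mem_preimage, Set.mem_singleton_iff, Units.val_inj]⟩⟩

/-- The real value `± 1` of the spin at the site `i`. -/
def spin {N : ℕ} (σ : Config N) (i : Fin N) : ℝ := ((σ i : ℤ) : ℝ)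

/-- The Hamiltonian with free boundary condition; every unordered pair of distinct sites
contributes once. -/
noncomputable def energy {N : ℕ} (J : ℕ → ℝ) (h : ℝ) (σ : Config N) : ℝ :=
  -(∑ i : Fin N, ∑ j ∈ Finset.Ioi i, J ((j : ℕ) - (i : ℕ)) * spin σ i * spin σ j)
    - ∑ i : Fin N, h * spin σ i

/-- All spins equal to `-1`. -/
def allMinus (N : ℕ) : Config N := fun _ => -1

/-- All spins equal to `+1`. -/
def allPlus (N : ℕ) : Config N := fun _ => 1

/-- The configuration whose `k` leftmost spins are `+1` and whose other spins are `-1`. -/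
def leftDroplet (N k : ℕ) : Config N := fun i => if (i : ℕ) < k then 1 else -1

/-- The configuration whose `k` rightmost spins are `+1` and whose other spins are `-1`. -/
def rightDroplet (N k : ℕ) : Config N := fun i => if (i : ℕ) < N - k then -1 else 1

theorem energy_rightDroplet (N k : ℕ) (J : ℕ → ℝ) (h : ℝ) :
    energy J h (rightDroplet N k) = energy J h (leftDroplet N k) := by
  have hs : ∀ i : Fin N, spin (rightDroplet N k) i.rev = spin (leftDroplet N k) i := by
    intro i
    have hi := i.2
    simp only [spin, rightDroplet, leftDroplet, Fin.val_rev]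
    by_cases hk : (i : ℕ) < k
    · rw [if_pos hk, if_neg (by omega)]
    · rw [if_neg hk, if_pos (by omega)]
  have hIoi : ∀ (i : Fin N) (f : Fin N → ℝ),
      ∑ j ∈ Finset.Ioi i, f j = ∑ j, if i < j then f j else 0 := by
    intro i f
    rw [← Finset.sum_filter]
    congr 1
    ext j
    simp
  unfold energy
  congr 1
  · congr 1
    simp only [hIoi]
    rw [Finset.sum_comm, ← Equiv.sum_comp Fin.revPerm]
    refine Finset.sum_congr rfl fun i _ => ?_
    rw [← Equiv.sum_comp Fin.revPerm]
    refine Finset.sum_congr rfl fun j _ => ?_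
    simp only [Fin.revPerm_apply, Fin.rev_lt_rev, hs, Fin.val_rev]
    have hi := i.2
    have hj := j.2
    split_ifs with hij
    · have : N - ((i : ℕ) + 1) - (N - ((j : ℕ) + 1)) = (j : ℕ) - (i : ℕ) := by
        have := Fin.lt_def.1 hij
        omega
      rw [this]
      ring
    · rfl
  · rw [← Equiv.sum_comp Fin.revPerm]
    exact Finset.sum_congr rfl fun i _ => by rw [Fin.revPerm_apply, hs]

/-- The barrier `Γ`: the maximal energy, over `k = 0, …, N`, of a droplet of `k` plus spins at an
end of the interval, minus the energy of the all-minus configuration. The left and the right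
droplet have the same energy, see `energy_rightDroplet`. -/
noncomputable def barrier (N : ℕ) (J : ℕ → ℝ) (h : ℝ) : ℝ :=
  (Finset.range (N + 1)).sup' Finset.nonempty_range_add_one
      (fun k => energy J h (leftDroplet N k))
    - energy J h (allMinus N)

/-- The connectivity matrix of single spin flips: `1 / N` if the two configurations differ at
exactly one site, and `0` otherwise. -/
noncomputable def connectivity {N : ℕ} (σ η : Config N) : ℝ :=
  if hammingDist σ η = 1 then 1 / (N : ℝ) else 0

/-- The Metropolis probability of a move from `σ` to `η`, for `η ≠ σ`. -/
noncomputable def flipRate {N : ℕ} (J : ℕ → ℝ) (h : ℝ) (β : ℝ≥0) (σ η : Config N) : ℝ :=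
  connectivity σ η * Real.exp (-(β : ℝ) * max (energy J h η - energy J h σ) 0)

/-- The Metropolis transition matrix; the diagonal entry is the probability that the proposed
flip is rejected, so that the rows sum to one. -/
noncomputable def transition {N : ℕ} (J : ℕ → ℝ) (h : ℝ) (β : ℝ≥0) (σ η : Config N) : ℝ :=
  if η = σ then 1 - ∑ ξ ∈ Finset.univ.erase σ, flipRate J h β σ ξ else flipRate J h β σ η

theorem connectivity_nonneg {N : ℕ} (σ η : Config N) : 0 ≤ connectivity σ η := by
  unfold connectivity
  split_ifs <;> positivity

theorem flipRate_nonneg {N : ℕ} (J : ℕ → ℝ) (h : ℝ) (β : ℝ≥0) (σ η : Config N) :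
    0 ≤ flipRate J h β σ η :=
  mul_nonneg (connectivity_nonneg σ η) (Real.exp_pos _).le

theorem flipRate_le_connectivity {N : ℕ} (J : ℕ → ℝ) (h : ℝ) (β : ℝ≥0) (σ η : Config N) :
    flipRate J h β σ η ≤ connectivity σ η := by
  unfold flipRate
  refine mul_le_of_le_one_right (connectivity_nonneg σ η) (Real.exp_le_one_iff.2 ?_)
  have h1 : 0 ≤ (β : ℝ) := β.2
  have h2 : 0 ≤ max (energy J h η - energy J h σ) 0 := le_max_right _ _
  nlinarith [mul_nonneg h1 h2]

theorem card_neighbours_le {N : ℕ} (σ : Config N) :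
    (Finset.univ.filter fun η : Config N => hammingDist σ η = 1).card ≤ N := by
  have hsub : (Finset.univ.filter fun η : Config N => hammingDist σ η = 1) ⊆
      Finset.univ.image (fun i : Fin N => Function.update σ i (-σ i)) := by
    intro η hη
    rw [Finset.mem_filter, hammingDist, Finset.card_eq_one] at hη
    obtain ⟨-, i, hi⟩ := hη
    refine Finset.mem_image.2 ⟨i, Finset.mem_univ _, ?_⟩
    have hiff : ∀ j, σ j ≠ η j ↔ j = i := by
      intro j
      have := Finset.ext_iff.1 hi j
      simpa using this
    funext j
    by_cases hj : j = i
    · subst hj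
      have hne := (hiff j).2 rfl
      rw [Function.update_self]
      rcases Int.units_eq_one_or (σ j) with h1 | h1 <;>
        rcases Int.units_eq_one_or (η j) with h2 | h2 <;> simp_all
    · rw [Function.update_of_ne hj]
      by_contra hne
      exact hj ((hiff j).1 hne)
  calc _ ≤ _ := Finset.card_le_card hsub
    _ ≤ (Finset.univ : Finset (Fin N)).card := Finset.card_image_le
    _ = N := by simp

theorem sum_flipRate_le_one {N : ℕ} (J : ℕ → ℝ) (h : ℝ) (β : ℝ≥0) (σ : Config N) :
    ∑ ξ ∈ Finset.univ.erase σ, flipRate J h β σ ξ ≤ 1 := by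
  calc ∑ ξ ∈ Finset.univ.erase σ, flipRate J h β σ ξ
      ≤ ∑ ξ, flipRate J h β σ ξ :=
        Finset.sum_le_sum_of_subset_of_nonneg (Finset.erase_subset _ _)
          fun _ _ _ => flipRate_nonneg J h β σ _
    _ ≤ ∑ ξ, connectivity σ ξ :=
        Finset.sum_le_sum fun ξ _ => flipRate_le_connectivity J h β σ ξ
    _ = ((Finset.univ.filter fun η : Config N => hammingDist σ η = 1).card : ℝ)
          * (1 / (N : ℝ)) := by
        simp only [connectivity]
        rw [← Finset.sum_filter, Finset.sum_const, nsmul_eq_mul]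
    _ ≤ (N : ℝ) * (1 / (N : ℝ)) := by
        have := card_neighbours_le σ
        gcongr
    _ ≤ 1 := by
        rw [mul_one_div]
        exact div_self_le_one _

theorem transition_nonneg {N : ℕ} (J : ℕ → ℝ) (h : ℝ) (β : ℝ≥0) (σ η : Config N) :
    0 ≤ transition J h β σ η := by
  unfold transition
  split_ifs
  · linarith [sum_flipRate_le_one J h β σ]
  · exact flipRate_nonneg J h β σ η

theorem sum_transition {N : ℕ} (J : ℕ → ℝ) (h : ℝ) (β : ℝ≥0) (σ : Config N) :
    ∑ η, transition J h β σ η = 1 := by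
  rw [← Finset.add_sum_erase _ _ (Finset.mem_univ σ)]
  have : ∑ η ∈ Finset.univ.erase σ, transition J h β σ η
      = ∑ η ∈ Finset.univ.erase σ, flipRate J h β σ η :=
    Finset.sum_congr rfl fun η hη => by
      rw [transition, if_neg (Finset.ne_of_mem_erase hη)]
  rw [this, transition, if_pos rfl]
  ring

/-- The law of the next configuration when the present one is `σ`. -/
noncomputable def stepPMF {N : ℕ} (J : ℕ → ℝ) (h : ℝ) (β : ℝ≥0) (σ : Config N) :
    PMF (Config N) :=
  PMF.ofFintype (fun η => ENNReal.ofReal (transition J h β σ η)) (by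
    rw [← ENNReal.ofReal_sum_of_nonneg fun η _ => transition_nonneg J h β σ η,
      sum_transition, ENNReal.ofReal_one])

/-- The transition matrix as a Markov kernel on the finite set of configurations. -/
noncomputable def stepKernel {N : ℕ} (J : ℕ → ℝ) (h : ℝ) (β : ℝ≥0) :
    Kernel (Config N) (Config N) :=
  Kernel.ofFunOfCountable fun σ => (stepPMF J h β σ).toMeasure

instance {N : ℕ} (J : ℕ → ℝ) (h : ℝ) (β : ℝ≥0) :
    IsMarkovKernel (stepKernel (N := N) J h β) :=
  ⟨fun σ => inferInstanceAs (IsProbabilityMeasure (stepPMF J h β σ).toMeasure)⟩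

/-- The law of the state at time `n + 1` given the states at times `0, …, n`: it depends on the
state at time `n` only, through the transition matrix. -/
noncomputable def historyKernel {N : ℕ} (J : ℕ → ℝ) (h : ℝ) (β : ℝ≥0) (n : ℕ) :
    Kernel ((i : Finset.Iic n) → Config N) (Config N) :=
  (stepKernel J h β).comap (fun x => x ⟨n, Finset.mem_Iic.2 le_rfl⟩) (measurable_pi_apply _)

instance {N : ℕ} (J : ℕ → ℝ) (h : ℝ) (β : ℝ≥0) (n : ℕ) :
    IsMarkovKernel (historyKernel (N := N) J h β n) := by
  unfold historyKernel
  infer_instance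

/-- The law, on the space of trajectories `X : ℕ → Config N`, of the discrete-time Metropolis
chain started at `σ` (Ionescu-Tulcea). -/
noncomputable def chainLaw {N : ℕ} (J : ℕ → ℝ) (h : ℝ) (β : ℝ≥0) (σ : Config N) :
    Measure (ℕ → Config N) :=
  Kernel.traj (X := fun _ => Config N) (historyKernel J h β) 0 fun _ => σ

/-- The hitting time `inf {t > 0 : X t = η}`, equal to `⊤` if `η` is never reached. -/
noncomputable def hittingTime {N : ℕ} (η : Config N) (X : ℕ → Config N) : ℕ∞ :=
  ⨅ (t : ℕ) (_ : 0 < t ∧ X t = η), (t : ℕ∞)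

end LongRangeIsing

namespace LongRangeIsing

/-! Two facts about the energy landscape carry the proof. Write Γ for `barrier`.

The barrier cannot be avoided. Among configurations with k plus spins the end droplet has least
energy (`energy_leftDroplet_le`): up to terms depending only on k, the energy is minus twice the
interaction inside the plus set and inside the minus set. With J nonincreasing an interval maximizes
such an interaction, and for the end droplet both sets are intervals. A chain of single flips from
all minus to all plus must visit the level k at which the droplet energy is maximal, where every
energy is at least Γ above the start. By reversibility each such configuration is occupied at a
given time with probability at most exp(-βΓ), so a union bound over times makes τ ≤ exp(β(Γ-ε))
unlikely.

No configuration is a deeper trap. From any σ, turning the spins plus from left to right never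
raises the energy by more than Γ above that of σ (`energy_fillLeft_le`). This follows from
submodularity of the ferromagnetic energy, the isoperimetric bound, and concavity of the droplet
energy in k. The Green function g(x) = G(x, y) of the chain killed at all plus has Dirichlet energy
at most w(y) g(y), with w the Gibbs weight. Along the filling path from y it falls from g(y) to 0,
so some edge carries a drop of at least g(y)/N, and that edge has conductance at least w(y)
exp(-βΓ)/N. Hence g(y) ≤ 2N³ exp(βΓ) (`green_diag_le`), and summing over y bounds E(τ). Markov's
inequality then gives the upper tail, and the lower tail gives the lower bound on E(τ). -/

/-! ### Isoperimetry: intervals maximize the internal interaction -/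

/-- The total interaction between the pairs of points of `A`. -/
noncomputable def pairSum (J : ℕ → ℝ) (A : Finset ℕ) : ℝ :=
  ∑ j ∈ A, ∑ i ∈ A with i < j, J (j - i)

/-- The interaction of a point with the `n` points next to it on one side. -/
noncomputable def arm (J : ℕ → ℝ) (n : ℕ) : ℝ := ∑ m ∈ Finset.range n, J (m + 1)

/-- The total interaction between the pairs of points of an interval of length `k`. -/
noncomputable def intervalSum (J : ℕ → ℝ) (k : ℕ) : ℝ := ∑ n ∈ Finset.range k, arm J n

theorem pairSum_insert_max (J : ℕ → ℝ) (a : ℕ) (A : Finset ℕ) (ha : ∀ x ∈ A, x < a) :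
    pairSum J (insert a A) = pairSum J A + ∑ i ∈ A, J (a - i) := by
  have hna : a ∉ A := fun h => (ha a h).false
  unfold pairSum
  rw [Finset.sum_insert hna, add_comm]
  congr 1
  · refine Finset.sum_congr rfl fun j hj => ?_
    congr 1
    rw [Finset.filter_insert, if_neg (ha j hj).not_gt]
  · congr 1
    rw [Finset.filter_insert, if_neg (lt_irrefl a), Finset.filter_true_of_mem ha]

/-- The distances from `a` to the points of `A` are distinct positive integers, so the r-th smallest
is at least r, and `J` is nonincreasing. The induction adds the farthest point `b`: the points
already present lie strictly between `b` and `a`, which forces `a - b` to exceed their number. -/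
theorem sum_sub_le_arm {J : ℕ → ℝ} (hJ : AntitoneOn J (Set.Ici 1)) (a : ℕ) (A : Finset ℕ)
    (ha : ∀ x ∈ A, x < a) : ∑ i ∈ A, J (a - i) ≤ arm J A.card := by
  induction A using Finset.induction_on_min with
  | empty => simp [arm]
  | insert b A hb ih =>
    have hnb : b ∉ A := fun h => (hb b h).false
    rw [Finset.sum_insert hnb, Finset.card_insert_of_notMem hnb, arm, Finset.sum_range_succ,
      ← arm, add_comm]
    have hba := ha b (Finset.mem_insert_self _ _)
    have hcard : A.card ≤ a - (b + 1) := by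
      rw [← Nat.card_Ico]
      refine Finset.card_le_card fun x hx => Finset.mem_Ico.2 ⟨hb x hx, ?_⟩
      exact ha x (Finset.mem_insert_of_mem hx)
    have h1 := ih fun x hx => ha x (Finset.mem_insert_of_mem hx)
    have h2 : J (a - b) ≤ J (A.card + 1) :=
      hJ (Set.mem_Ici.2 (by omega)) (Set.mem_Ici.2 (by omega)) (by omega)
    linarith

/-- The points are added in increasing order; each new maximum interacts with the n earlier points
by at most `arm J n`, which is what it does when they form an interval adjacent to it. -/
theorem pairSum_le_intervalSum {J : ℕ → ℝ} (hJ : AntitoneOn J (Set.Ici 1)) (A : Finset ℕ) :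
    pairSum J A ≤ intervalSum J A.card := by
  induction A using Finset.induction_on_max with
  | empty => simp [pairSum, intervalSum]
  | insert a A ha ih =>
    rw [pairSum_insert_max J a A ha, Finset.card_insert_of_notMem fun h => (ha a h).false,
      intervalSum, Finset.sum_range_succ, ← intervalSum]
    exact add_le_add ih (sum_sub_le_arm hJ a A ha)

theorem pairSum_Ico (J : ℕ → ℝ) (m k : ℕ) :
    pairSum J (Finset.Ico m (m + k)) = intervalSum J k := by
  induction k with
  | zero => simp [pairSum, intervalSum]
  | succ k ih =>
    rw [← add_assoc, ← Finset.insert_Ico_right_eq_Ico_add_one (Nat.le_add_right m k),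
      pairSum_insert_max _ _ _ fun x hx => (Finset.mem_Ico.1 hx).2, ih, intervalSum, intervalSum,
      Finset.sum_range_succ, arm, Finset.sum_Ico_eq_sum_range]
    congr 1
    rw [Nat.add_sub_cancel_left, ← Finset.sum_range_reflect]
    refine Finset.sum_congr rfl fun i hi => ?_
    have := Finset.mem_range.1 hi
    congr 1
    omega

theorem pairSum_eq_sum_range (J : ℕ → ℝ) {N : ℕ} {A : Finset ℕ} (hA : A ⊆ Finset.range N) :
    pairSum J A = ∑ i ∈ Finset.range N, ∑ j ∈ Finset.range N,
      if i < j then (if i ∈ A ∧ j ∈ A then J (j - i) else 0) else 0 := by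
  rw [Finset.sum_comm, pairSum]
  have h1 : ∀ j, (∑ i ∈ A with i < j, J (j - i))
      = ∑ i ∈ Finset.range N, if i < j ∧ i ∈ A then J (j - i) else 0 := by
    intro j
    rw [← Finset.sum_filter]
    congr 1
    ext i
    simp only [Finset.mem_filter, Finset.mem_range]
    constructor
    · exact fun h => ⟨Finset.mem_range.1 (hA h.1), h.2, h.1⟩
    · exact fun h => ⟨h.2.2, h.2.1⟩
  simp only [h1]
  rw [← Finset.sum_subset hA (f := fun j => ∑ i ∈ Finset.range N,
    if i < j then (if i ∈ A ∧ j ∈ A then J (j - i) else 0) else 0)]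
  · refine Finset.sum_congr rfl fun j hj => Finset.sum_congr rfl fun i _ => ?_
    simp only [hj, and_true, ite_and]
  · intro j _ hj
    simp [hj]

/-! ### The energy in terms of the set of plus spins -/

/-- The set of plus spins, as a set of natural numbers below `N`. -/
def plusSet {N : ℕ} (σ : Config N) : Finset ℕ :=
  (Finset.univ.filter fun i => σ i = 1).map Fin.valEmbedding

theorem plusSet_subset {N : ℕ} (σ : Config N) : plusSet σ ⊆ Finset.range N := by
  intro x hx
  obtain ⟨i, -, rfl⟩ := Finset.mem_map.1 hx
  simp

theorem val_mem_plusSet {N : ℕ} (σ : Config N) (i : Fin N) : (i : ℕ) ∈ plusSet σ ↔ σ i = 1 := by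
  simp [plusSet, Fin.val_inj]

theorem spin_eq_ite {N : ℕ} (σ : Config N) (i : Fin N) :
    spin σ i = if (i : ℕ) ∈ plusSet σ then 1 else -1 := by
  rw [spin]
  rcases Int.units_eq_one_or (σ i) with h | h
  · rw [if_pos ((val_mem_plusSet σ i).2 h), h]
    simp
  · rw [if_neg, h]
    · simp
    · rw [val_mem_plusSet, h]
      decide

/-- For a product of spins, -σᵢσⱼ is 1 minus twice the indicator that the spins agree, and they
agree exactly when both sites lie in the plus set or both in its complement. -/
theorem energy_eq_pairSum (N : ℕ) (J : ℕ → ℝ) (h : ℝ) (σ : Config N) :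
    energy J h σ = intervalSum J N
      - 2 * (pairSum J (plusSet σ) + pairSum J (Finset.range N \ plusSet σ))
      - h * (2 * (plusSet σ).card - N) := by
  set A := plusSet σ with hA
  have hsub : A ⊆ Finset.range N := plusSet_subset σ
  set s : ℕ → ℝ := fun n => if n ∈ A then 1 else -1 with hs
  have hspin : ∀ i : Fin N, spin σ i = s i := spin_eq_ite σ
  have h1 : ∑ i : Fin N, ∑ j ∈ Finset.Ioi i, J ((j : ℕ) - (i : ℕ)) * spin σ i * spin σ j
      = ∑ i ∈ Finset.range N, ∑ j ∈ Finset.range N,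
        if i < j then J (j - i) * s i * s j else 0 := by
    rw [← Fin.sum_univ_eq_sum_range (fun i => ∑ j ∈ Finset.range N,
        if i < j then J (j - i) * s i * s j else 0)]
    refine Finset.sum_congr rfl fun i _ => ?_
    rw [← Fin.sum_univ_eq_sum_range (fun j =>
        if (i : ℕ) < j then J (j - i) * s i * s j else 0)]
    simp only [Fin.val_fin_lt, hspin]
    rw [← Finset.sum_filter]
    congr 1
    ext j
    simp
  have h2 : ∑ i : Fin N, h * spin σ i = h * (2 * A.card - N) := by
    rw [← Finset.mul_sum]
    congr 1
    simp only [hspin]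
    rw [Fin.sum_univ_eq_sum_range s]
    have : ∀ n, s n = 2 * (if n ∈ A then 1 else 0) - 1 := by
      intro n
      simp only [hs]
      split_ifs <;> norm_num
    simp only [this]
    rw [Finset.sum_sub_distrib, ← Finset.mul_sum, ← Finset.sum_filter,
      Finset.filter_mem_eq_inter, Finset.inter_eq_right.2 hsub]
    simp
  have h3 : intervalSum J N = pairSum J (Finset.range N) := by
    have := pairSum_Ico J 0 N
    rw [zero_add] at this
    rw [← this, Finset.range_eq_Ico]
  rw [energy, h1, h2, h3, pairSum_eq_sum_range J hsub, pairSum_eq_sum_range J Finset.sdiff_subset,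
    pairSum_eq_sum_range J subset_rfl, ← Finset.sum_add_distrib, Finset.mul_sum,
    ← Finset.sum_sub_distrib, ← Finset.sum_neg_distrib]
  congr 1
  refine Finset.sum_congr rfl fun i hi => ?_
  rw [← Finset.sum_add_distrib, Finset.mul_sum, ← Finset.sum_sub_distrib,
    ← Finset.sum_neg_distrib]
  refine Finset.sum_congr rfl fun j hj => ?_
  simp only [hs, Finset.mem_sdiff, hi, hj, true_and]
  split_ifs <;> first | tauto | ring

/-! ### Droplet energies and the barrier -/

theorem plusSet_leftDroplet {N k : ℕ} (hk : k ≤ N) :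
    plusSet (leftDroplet N k) = Finset.range k := by
  ext n
  simp only [plusSet, Finset.mem_map, Finset.mem_filter, Finset.mem_univ, true_and,
    Fin.valEmbedding_apply, Finset.mem_range]
  constructor
  · rintro ⟨i, hi, rfl⟩
    by_contra hcon
    unfold leftDroplet at hi
    rw [if_neg hcon] at hi
    exact absurd hi (by decide)
  · intro hn
    exact ⟨⟨n, by omega⟩, by simp [leftDroplet, hn], rfl⟩

theorem energy_leftDroplet {N k : ℕ} (hk : k ≤ N) (J : ℕ → ℝ) (h : ℝ) :
    energy J h (leftDroplet N k) = intervalSum J N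
      - 2 * (intervalSum J k + intervalSum J (N - k)) - h * (2 * k - N) := by
  have h1 : Finset.range N \ Finset.range k = Finset.Ico k (k + (N - k)) := by
    ext n
    simp only [Finset.mem_sdiff, Finset.mem_range, Finset.mem_Ico]
    omega
  have h2 := pairSum_Ico J 0 k
  rw [zero_add, ← Finset.range_eq_Ico] at h2
  rw [energy_eq_pairSum, plusSet_leftDroplet hk, h1, pairSum_Ico, h2, Finset.card_range]

theorem card_plusSet_le {N : ℕ} (σ : Config N) : (plusSet σ).card ≤ N := by
  simpa using Finset.card_le_card (plusSet_subset σ)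

/-- Among the configurations with a given number of plus spins, the droplet at the end of the
interval minimizes the energy. -/
theorem energy_leftDroplet_le {N : ℕ} {J : ℕ → ℝ} (hJ : AntitoneOn J (Set.Ici 1)) (h : ℝ)
    (σ : Config N) : energy J h (leftDroplet N (plusSet σ).card) ≤ energy J h σ := by
  rw [energy_leftDroplet (card_plusSet_le σ), energy_eq_pairSum N J h σ]
  -- The plus and the minus sites are bounded separately; the end droplet attains both bounds at
  -- once.
  have h1 := pairSum_le_intervalSum hJ (plusSet σ)
  have h2 := pairSum_le_intervalSum hJ (Finset.range N \ plusSet σ)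
  rw [Finset.card_sdiff_of_subset (plusSet_subset σ), Finset.card_range] at h2
  linarith

theorem allMinus_eq_leftDroplet (N : ℕ) : allMinus N = leftDroplet N 0 := by
  funext i
  simp [allMinus, leftDroplet]

theorem allPlus_eq_leftDroplet (N : ℕ) : allPlus N = leftDroplet N N := by
  funext i
  simp [allPlus, leftDroplet]

/-- The flipped site loses its bonds to the minus spins on its right and gains those to the plus
spins on its left. For positive `J` the increment is nonincreasing in `k`, which is the concavity
used below. -/
theorem energy_leftDroplet_succ_sub {N k : ℕ} (hk : k < N) (J : ℕ → ℝ) (h : ℝ) :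
    energy J h (leftDroplet N (k + 1)) - energy J h (leftDroplet N k)
      = 2 * arm J (N - (k + 1)) - 2 * arm J k - 2 * h := by
  rw [energy_leftDroplet hk, energy_leftDroplet hk.le]
  obtain ⟨m, rfl⟩ := Nat.exists_eq_add_of_lt hk
  have h1 : k + m + 1 - k = m + 1 := by omega
  have h2 : k + m + 1 - (k + 1) = m := by omega
  simp only [h1, h2, intervalSum, Finset.sum_range_succ _ k, Finset.sum_range_succ _ m]
  push_cast
  ring

theorem arm_mono {J : ℕ → ℝ} (hJ : ∀ n, 1 ≤ n → 0 < J n) : Monotone (arm J) :=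
  monotone_nat_of_le_succ fun n => by
    rw [arm, arm, Finset.sum_range_succ]
    linarith [hJ (n + 1) (by omega)]

theorem energy_leftDroplet_sub_le_barrier_of_le {N k : ℕ} (hk : k ≤ N) (J : ℕ → ℝ) (h : ℝ) :
    energy J h (leftDroplet N k) - energy J h (allMinus N) ≤ barrier N J h := by
  unfold barrier
  gcongr
  exact Finset.le_sup' (fun k => energy J h (leftDroplet N k)) (by simpa using Nat.lt_succ_of_le hk)

theorem barrier_nonneg (N : ℕ) (J : ℕ → ℝ) (h : ℝ) : 0 ≤ barrier N J h := by
  have := energy_leftDroplet_sub_le_barrier_of_le (Nat.zero_le N) J h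
  rwa [← allMinus_eq_leftDroplet, sub_self] at this

theorem exists_energy_leftDroplet_eq (N : ℕ) (J : ℕ → ℝ) (h : ℝ) :
    ∃ k ≤ N, energy J h (leftDroplet N k) - energy J h (allMinus N) = barrier N J h := by
  obtain ⟨k, hk, hk'⟩ := Finset.exists_mem_eq_sup' Finset.nonempty_range_add_one
      (fun k => energy J h (leftDroplet N k)) (s := Finset.range (N + 1))
  exact ⟨k, by simpa [Nat.lt_succ_iff] using hk, by rw [barrier, hk']⟩

/-- Droplet energies are concave in the size of the droplet, so growing never costs more than the
barrier. -/
theorem energy_leftDroplet_sub_le_barrier {N : ℕ} {J : ℕ → ℝ} (hJ : ∀ n, 1 ≤ n → 0 < J n) (h : ℝ)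
    {m k : ℕ} (hmk : m ≤ k) (hk : k ≤ N) :
    energy J h (leftDroplet N k) - energy J h (leftDroplet N m) ≤ barrier N J h := by
  have hb := energy_leftDroplet_sub_le_barrier_of_le hk J h
  by_cases hm : energy J h (allMinus N) ≤ energy J h (leftDroplet N m)
  · linarith
  · push Not at hm
    -- If the droplet of size `m` lies below all minus, some increment before `m` is negative; by
    -- concavity all later ones are, so the energy only falls beyond `m`.
    obtain ⟨i, him, hi⟩ : ∃ i < m,
        energy J h (leftDroplet N (i + 1)) - energy J h (leftDroplet N i) < 0 := by
      by_contra! hcon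
      have : 0 ≤ ∑ i ∈ Finset.range m,
          (energy J h (leftDroplet N (i + 1)) - energy J h (leftDroplet N i)) :=
        Finset.sum_nonneg fun i hi => hcon i (Finset.mem_range.1 hi)
      rw [Finset.sum_range_sub (fun i => energy J h (leftDroplet N i)),
        ← allMinus_eq_leftDroplet] at this
      linarith
    have hdec : ∀ l, m ≤ l → l ≤ N →
        energy J h (leftDroplet N l) ≤ energy J h (leftDroplet N m) := by
      intro l hl
      induction l, hl using Nat.le_induction with
      | base => exact fun _ => le_rfl
      | succ l hl ih =>
        intro hlN
        have h1 := energy_leftDroplet_succ_sub (show l < N by omega) J h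
        rw [energy_leftDroplet_succ_sub (by omega)] at hi
        have h2 := arm_mono hJ (show N - (l + 1) ≤ N - (i + 1) by omega)
        have h3 := arm_mono hJ (show i ≤ l by omega)
        linarith [ih (by omega)]
    linarith [hdec k hmk hk, barrier_nonneg N J h]

/-- The first flip at the end already costs energy: this is the upper bound on `h`. -/
theorem barrier_pos {N : ℕ} (hN : 2 ≤ N) {J : ℕ → ℝ} {h : ℝ}
    (h_lt : h < ∑ n ∈ Finset.Icc 1 (N - 1), J n) : 0 < barrier N J h := by
  have h1 := energy_leftDroplet_sub_le_barrier_of_le (show 1 ≤ N by omega) J h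
  have h2 := energy_leftDroplet_succ_sub (show 0 < N by omega) J h
  have h3 : arm J (N - (0 + 1)) = ∑ n ∈ Finset.Icc 1 (N - 1), J n := by
    rw [arm, ← Finset.Ico_add_one_right_eq_Icc, Finset.sum_Ico_eq_sum_range]
    simp only [Nat.add_sub_cancel, zero_add, add_comm 1]
  have h4 : arm J 0 = 0 := by simp [arm]
  rw [h3, h4, zero_add, ← allMinus_eq_leftDroplet] at h2
  linarith

/-! ### A path to all plus that climbs at most Γ -/

/-- The configuration obtained from `σ` by flipping the `k` leftmost spins to plus. -/
def fillLeft {N : ℕ} (σ : Config N) (k : ℕ) : Config N := fun i => if (i : ℕ) < k then 1 else σ i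

/-- The configuration obtained from `σ` by keeping plus spins among the `k` leftmost sites only. -/
def cutLeft {N : ℕ} (σ : Config N) (k : ℕ) : Config N := fun i => if (i : ℕ) < k then σ i else -1

/-- Submodularity: `fillLeft σ k` and `cutLeft σ k` are the join and the meet of `σ` with the
droplet. The field terms balance, and the pair terms differ only for `i < k ≤ j`, by `J (j - i) * (1
- σᵢ) * (1 + σⱼ) ≥ 0`. -/
theorem energy_fillLeft_add_energy_cutLeft_le {N : ℕ} {J : ℕ → ℝ} (hJ : ∀ n, 1 ≤ n → 0 < J n)
    (h : ℝ) (σ : Config N) (k : ℕ) :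
    energy J h (fillLeft σ k) + energy J h (cutLeft σ k)
      ≤ energy J h σ + energy J h (leftDroplet N k) := by
  have hspin : ∀ i, -1 ≤ spin σ i ∧ spin σ i ≤ 1 := by
    intro i
    rw [spin_eq_ite]
    split_ifs <;> norm_num
  have e1 : ∀ i, spin (fillLeft σ k) i = if (i : ℕ) < k then 1 else spin σ i := by
    intro i
    simp only [spin, fillLeft]
    split_ifs <;> simp
  have e2 : ∀ i, spin (cutLeft σ k) i = if (i : ℕ) < k then spin σ i else -1 := by
    intro i
    simp only [spin, cutLeft]
    split_ifs <;> simp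
  have e3 : ∀ i, spin (leftDroplet N k) i = if (i : ℕ) < k then 1 else -1 := by
    intro i
    simp only [spin, leftDroplet]
    split_ifs <;> simp
  have hf : ∑ i : Fin N, h * spin (fillLeft σ k) i + ∑ i : Fin N, h * spin (cutLeft σ k) i
      = ∑ i : Fin N, h * spin σ i + ∑ i : Fin N, h * spin (leftDroplet N k) i := by
    rw [← Finset.sum_add_distrib, ← Finset.sum_add_distrib]
    refine Finset.sum_congr rfl fun i _ => ?_
    rw [e1, e2, e3]
    split_ifs <;> ring
  have hp : ∑ i : Fin N, ∑ j ∈ Finset.Ioi i, J ((j : ℕ) - (i : ℕ)) * spin σ i * spin σ j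
      + ∑ i : Fin N, ∑ j ∈ Finset.Ioi i,
        J ((j : ℕ) - (i : ℕ)) * spin (leftDroplet N k) i * spin (leftDroplet N k) j
      ≤ ∑ i : Fin N, ∑ j ∈ Finset.Ioi i,
        J ((j : ℕ) - (i : ℕ)) * spin (fillLeft σ k) i * spin (fillLeft σ k) j
      + ∑ i : Fin N, ∑ j ∈ Finset.Ioi i,
        J ((j : ℕ) - (i : ℕ)) * spin (cutLeft σ k) i * spin (cutLeft σ k) j := by
    rw [← Finset.sum_add_distrib, ← Finset.sum_add_distrib]
    refine Finset.sum_le_sum fun i _ => ?_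
    rw [← Finset.sum_add_distrib, ← Finset.sum_add_distrib]
    refine Finset.sum_le_sum fun j hj => ?_
    have hij : (i : ℕ) < j := Fin.lt_def.1 (Finset.mem_Ioi.1 hj)
    have hJ0 := (hJ (j - i) (by omega)).le
    simp only [e1, e2, e3]
    by_cases hi : (i : ℕ) < k <;> by_cases hj : (j : ℕ) < k
    · simp only [hi, hj, if_true]
      linarith
    · simp only [hi, hj, if_true, if_false]
      have := mul_nonneg hJ0 (mul_nonneg (sub_nonneg.2 (hspin i).2)
        (show 0 ≤ 1 + spin σ j by linarith [(hspin j).1]))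
      linarith
    · omega
    · simp only [hi, hj, if_false]
      linarith
  unfold energy
  linarith

theorem card_plusSet_cutLeft_le {N : ℕ} (σ : Config N) (k : ℕ) :
    (plusSet (cutLeft σ k)).card ≤ k := by
  refine (Finset.card_le_card fun n hn => ?_).trans_eq (Finset.card_range k)
  obtain ⟨i, hi, rfl⟩ := Finset.mem_map.1 hn
  simp only [Finset.mem_filter, Finset.mem_univ, true_and] at hi
  by_contra hcon
  rw [Finset.mem_range, Fin.valEmbedding_apply] at hcon
  unfold cutLeft at hi
  rw [if_neg hcon] at hi
  exact absurd hi (by decide)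

/-- Filling any configuration with plus spins from the left never costs more than the barrier. -/
theorem energy_fillLeft_le {N : ℕ} {J : ℕ → ℝ} (hJ_pos : ∀ n, 1 ≤ n → 0 < J n)
    (hJ_anti : AntitoneOn J (Set.Ici 1)) (h : ℝ) (σ : Config N) {k : ℕ} (hk : k ≤ N) :
    energy J h (fillLeft σ k) ≤ energy J h σ + barrier N J h := by
  have h1 := energy_fillLeft_add_energy_cutLeft_le hJ_pos h σ k
  have h2 := energy_leftDroplet_le hJ_anti h (cutLeft σ k)
  have h3 := energy_leftDroplet_sub_le_barrier hJ_pos h (card_plusSet_cutLeft_le σ k) hk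
  linarith

theorem fillLeft_zero {N : ℕ} (σ : Config N) : fillLeft σ 0 = σ := by
  funext i
  simp [fillLeft]

theorem fillLeft_self {N : ℕ} (σ : Config N) : fillLeft σ N = allPlus N := by
  funext i
  simp [fillLeft, allPlus]

theorem fillLeft_succ {N : ℕ} (σ : Config N) (k : ℕ) :
    fillLeft σ (k + 1) = fillLeft σ k ∨ hammingDist (fillLeft σ k) (fillLeft σ (k + 1)) = 1 := by
  by_cases heq : fillLeft σ (k + 1) = fillLeft σ k
  · exact Or.inl heq
  · right
    have h1 : hammingDist (fillLeft σ k) (fillLeft σ (k + 1)) ≠ 0 := by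
      rw [hammingDist_ne_zero]
      exact Ne.symm heq
    have h2 : hammingDist (fillLeft σ k) (fillLeft σ (k + 1)) ≤ 1 := by
      rw [hammingDist, Finset.card_le_one]
      have key : ∀ a ∈ Finset.univ.filter (fun i => fillLeft σ k i ≠ fillLeft σ (k + 1) i),
          (a : ℕ) = k := by
        intro a ha
        simp only [Finset.mem_filter, Finset.mem_univ, true_and] at ha
        unfold fillLeft at ha
        by_contra hak
        rcases lt_or_gt_of_ne hak with hl | hl
        · exact ha (by rw [if_pos hl, if_pos (by omega)])
        · exact ha (by rw [if_neg (by omega), if_neg (by omega)])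
      exact fun a ha b hb => Fin.ext ((key a ha).trans (key b hb).symm)
    omega

theorem card_plusSet_le_add_hammingDist {N : ℕ} (σ η : Config N) :
    (plusSet η).card ≤ (plusSet σ).card + hammingDist σ η := by
  simp only [plusSet, Finset.card_map, hammingDist]
  refine (Finset.card_le_card fun i hi => ?_).trans (Finset.card_union_le _ _)
  simp only [Finset.mem_filter, Finset.mem_univ, true_and, Finset.mem_union] at hi ⊢
  by_cases hs : σ i = 1
  · exact Or.inl hs
  · exact Or.inr (by rwa [hi])

/-! ### The killed chain and path probabilities -/

instance {N : ℕ} (J : ℕ → ℝ) (h : ℝ) (β : ℝ≥0) (σ : Config N) :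
    IsProbabilityMeasure (chainLaw J h β σ) := by
  unfold chainLaw
  infer_instance

/-- The transition matrix of the chain killed when it leaves a configuration of `D`. -/
noncomputable def killed {N : ℕ} (J : ℕ → ℝ) (h : ℝ) (β : ℝ≥0) (D : Finset (Config N)) :
    Matrix (Config N) (Config N) ℝ :=
  Matrix.of fun x z => if x ∈ D then 0 else transition J h β x z

theorem killed_nonneg {N : ℕ} (J : ℕ → ℝ) (h : ℝ) (β : ℝ≥0) (D : Finset (Config N))
    (x z : Config N) : 0 ≤ killed J h β D x z := by
  rw [killed, Matrix.of_apply]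
  split_ifs
  exacts [le_rfl, transition_nonneg J h β x z]

theorem sum_killed_le_one {N : ℕ} (J : ℕ → ℝ) (h : ℝ) (β : ℝ≥0) (D : Finset (Config N))
    (x : Config N) : ∑ z, killed J h β D x z ≤ 1 := by
  simp only [killed, Matrix.of_apply]
  split_ifs
  · simp
  · exact (sum_transition J h β x).le

theorem killed_pow_nonneg {N : ℕ} (J : ℕ → ℝ) (h : ℝ) (β : ℝ≥0) (D : Finset (Config N)) (t : ℕ)
    (x z : Config N) : 0 ≤ (killed J h β D ^ t) x z := by
  induction t generalizing x z with
  | zero =>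
    rw [pow_zero, Matrix.one_apply]
    split_ifs <;> norm_num
  | succ t ih =>
    rw [pow_succ, Matrix.mul_apply]
    exact Finset.sum_nonneg fun y _ => mul_nonneg (ih x y) (killed_nonneg J h β D y z)

theorem stepKernel_singleton {N : ℕ} (J : ℕ → ℝ) (h : ℝ) (β : ℝ≥0) (x z : Config N) :
    stepKernel J h β x {z} = ENNReal.ofReal (transition J h β x z) := by
  change (stepPMF J h β x).toMeasure {z} = _
  rw [PMF.toMeasure_apply_singleton _ _ (measurableSet_singleton z)]
  rfl

theorem chainLaw_zero {N : ℕ} (J : ℕ → ℝ) (h : ℝ) (β : ℝ≥0) (σ z : Config N) :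
    chainLaw J h β σ {X | X 0 = z} = if σ = z then 1 else 0 := by
  have hm : Measurable fun y : (i : Finset.Iic 0) → Config N => y ⟨0, Finset.mem_Iic.2 le_rfl⟩ :=
    measurable_pi_apply _
  have h1 : {X : ℕ → Config N | X 0 = z} = Preorder.frestrictLe 0 ⁻¹'
      ((fun y : (i : Finset.Iic 0) → Config N => y ⟨0, Finset.mem_Iic.2 le_rfl⟩) ⁻¹' {z}) := rfl
  have hs := hm (measurableSet_singleton z)
  rw [h1, ← Measure.map_apply (Preorder.measurable_frestrictLe (X := fun _ => Config N) 0) hs,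
    chainLaw,
    Kernel.traj_map_frestrictLe_apply, Kernel.partialTraj_self, Kernel.id_apply,
    Measure.dirac_apply' _ hs]
  classical
  rw [Set.indicator_apply]
  simp

/-- The Markov property on a past event `S`: the joint law of the history up to `n` and of the next
state is a composition product with `historyKernel`, which sees only the state at time `n`. -/
theorem chainLaw_succ {N : ℕ} (J : ℕ → ℝ) (h : ℝ) (β : ℝ≥0) (σ : Config N) (n : ℕ)
    {S : Set ((i : Finset.Iic n) → Config N)} (hS : MeasurableSet S) (z : Config N) :
    chainLaw J h β σ {X | Preorder.frestrictLe (π := fun _ => Config N) n X ∈ S ∧ X (n + 1) = z}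
      = ∑ x, ENNReal.ofReal (transition J h β x z) *
        chainLaw J h β σ {X | Preorder.frestrictLe (π := fun _ => Config N) n X ∈ S ∧ X n = x} := by
  have hm : Measurable fun y : (i : Finset.Iic n) → Config N => y ⟨n, Finset.mem_Iic.2 le_rfl⟩ :=
    measurable_pi_apply _
  have hr : Measurable (Preorder.frestrictLe (π := fun _ : ℕ => Config N) n) :=
    Preorder.measurable_frestrictLe (X := fun _ => Config N) n
  have h1 : {X | Preorder.frestrictLe (π := fun _ => Config N) n X ∈ S ∧ X (n + 1) = z}
      = (fun X : ℕ → Config N => (Preorder.frestrictLe (π := fun _ => Config N) n X, X (n + 1))) ⁻¹'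
        (S ×ˢ {z}) := rfl
  have h2 := Kernel.partialTraj_compProd_eq_map_traj (X := fun _ => Config N)
    (κ := historyKernel J h β) (Nat.zero_le n) (x₀ := fun _ => σ)
  rw [h1, ← Measure.map_apply (hr.prodMk (measurable_pi_apply _))
    (hS.prod (measurableSet_singleton z)), chainLaw, ← h2,
    Measure.compProd_apply_prod hS (measurableSet_singleton z)]
  have h3 : ∀ y : (i : Finset.Iic n) → Config N, historyKernel J h β n y {z}
      = ENNReal.ofReal (transition J h β (y ⟨n, Finset.mem_Iic.2 le_rfl⟩) z) := fun y => by
    rw [← stepKernel_singleton]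
    rfl
  simp only [h3]
  rw [← lintegral_map (f := fun x => ENNReal.ofReal (transition J h β x z))
    (measurable_of_finite _) hm, lintegral_fintype]
  refine Finset.sum_congr rfl fun x _ => ?_
  rw [Measure.map_apply hm (measurableSet_singleton x),
    Measure.restrict_apply (hm (measurableSet_singleton x)),
    ← Kernel.traj_map_frestrictLe_apply,
    Measure.map_apply hr ((hm (measurableSet_singleton x)).inter hS), Set.preimage_inter,
    Set.inter_comm]
  rfl

/-- The probability that the chain is at `z` at time `t`, without having visited `D` before. -/
theorem chainLaw_avoid_eq_killed_pow {N : ℕ} (J : ℕ → ℝ) (h : ℝ) (β : ℝ≥0)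
    (D : Finset (Config N)) (σ : Config N) (t : ℕ) (z : Config N) :
    chainLaw J h β σ {X | (∀ s < t, X s ∉ D) ∧ X t = z}
      = ENNReal.ofReal ((killed J h β D ^ t) σ z) := by
  induction t generalizing z with
  | zero =>
    simp only [Nat.not_lt_zero, false_imp_iff, implies_true, true_and, pow_zero]
    rw [chainLaw_zero, Matrix.one_apply]
    split_ifs <;> simp
  | succ t ih =>
    set S : Set ((i : Finset.Iic t) → Config N) := {y | ∀ i, y i ∉ D} with hS
    have hSm : MeasurableSet S := by
      rw [hS, Set.ofPred_forall]
      exact MeasurableSet.iInter fun i =>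
        show MeasurableSet ((fun y : (i : Finset.Iic t) → Config N => y i) ⁻¹' {x | x ∉ D}) from
          measurable_pi_apply i (Set.toFinite {x : Config N | x ∉ D}).measurableSet
    have h1 : {X : ℕ → Config N | (∀ s < t + 1, X s ∉ D) ∧ X (t + 1) = z}
        = {X | Preorder.frestrictLe (π := fun _ => Config N) t X ∈ S ∧ X (t + 1) = z} := by
      ext X
      simp only [hS, Set.mem_ofPred_eq, Preorder.frestrictLe_apply, Subtype.forall,
        Finset.mem_Iic, Nat.lt_succ_iff]
    rw [h1, chainLaw_succ J h β σ t hSm, pow_succ, Matrix.mul_apply,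
      ENNReal.ofReal_sum_of_nonneg fun y _ =>
        mul_nonneg (killed_pow_nonneg J h β D t σ y) (killed_nonneg J h β D y z)]
    refine Finset.sum_congr rfl fun x _ => ?_
    rw [ENNReal.ofReal_mul (killed_pow_nonneg J h β D t σ x), ← ih x, mul_comm, killed,
      Matrix.of_apply]
    -- `S` forbids `D` at time `t` too. For `x ∈ D` the event is empty and the row of the killed
    -- matrix is zero; otherwise the condition at time `t` is automatic.
    by_cases hx : x ∈ D
    · have : {X : ℕ → Config N |
          Preorder.frestrictLe (π := fun _ => Config N) t X ∈ S ∧ X t = x} = ∅ := by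
        ext X
        simp only [hS, Set.mem_ofPred_eq, Set.mem_empty_iff_false, iff_false, not_and]
        intro hX hXt
        exact hX ⟨t, Finset.mem_Iic.2 le_rfl⟩ (by simpa [hXt] using hx)
      rw [this]
      simp [hx]
    · have : {X : ℕ → Config N |
          Preorder.frestrictLe (π := fun _ => Config N) t X ∈ S ∧ X t = x}
          = {X | (∀ s < t, X s ∉ D) ∧ X t = x} := by
        ext X
        simp only [hS, Set.mem_ofPred_eq, Preorder.frestrictLe_apply, Subtype.forall,
          Finset.mem_Iic]
        constructor
        · exact fun hX => ⟨fun s hs => hX.1 s hs.le, hX.2⟩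
        · refine fun hX => ⟨fun s hs => ?_, hX.2⟩
          rcases hs.lt_or_eq with hlt | rfl
          · exact hX.1 s hlt
          · rw [hX.2]
            exact hx
      rw [this, if_neg hx]

/-! ### Reversibility -/

/-- The unnormalized Gibbs weight. -/
noncomputable def weight {N : ℕ} (J : ℕ → ℝ) (h : ℝ) (β : ℝ≥0) (σ : Config N) : ℝ :=
  Real.exp (-(β : ℝ) * energy J h σ)

theorem weight_pos {N : ℕ} (J : ℕ → ℝ) (h : ℝ) (β : ℝ≥0) (σ : Config N) :
    0 < weight J h β σ := Real.exp_pos _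

/-- The right side is symmetric in `σ` and `η`. It gives detailed balance, and also the conductance
of an edge in terms of the higher of its two energies. -/
theorem weight_mul_flipRate {N : ℕ} (J : ℕ → ℝ) (h : ℝ) (β : ℝ≥0) (σ η : Config N) :
    weight J h β σ * flipRate J h β σ η
      = connectivity σ η * Real.exp (-(β : ℝ) * max (energy J h σ) (energy J h η)) := by
  rw [weight, flipRate, mul_left_comm, ← Real.exp_add, ← mul_add,
    ← max_add_add_left, add_zero, add_sub_cancel, max_comm]

theorem weight_mul_transition_comm {N : ℕ} (J : ℕ → ℝ) (h : ℝ) (β : ℝ≥0) (σ η : Config N) :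
    weight J h β σ * transition J h β σ η = weight J h β η * transition J h β η σ := by
  by_cases hση : η = σ
  · rw [hση]
  · rw [transition, transition, if_neg hση, if_neg (Ne.symm hση), weight_mul_flipRate,
      weight_mul_flipRate, max_comm, connectivity, connectivity, hammingDist_comm]

theorem killed_empty_apply {N : ℕ} (J : ℕ → ℝ) (h : ℝ) (β : ℝ≥0) (x z : Config N) :
    killed J h β ∅ x z = transition J h β x z := by
  simp [killed]

theorem weight_mul_pow_comm {N : ℕ} (J : ℕ → ℝ) (h : ℝ) (β : ℝ≥0) (t : ℕ) (σ η : Config N) :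
    weight J h β σ * (killed J h β ∅ ^ t) σ η = weight J h β η * (killed J h β ∅ ^ t) η σ := by
  induction t generalizing σ η with
  | zero =>
    rw [pow_zero, Matrix.one_apply, Matrix.one_apply]
    by_cases hση : σ = η
    · rw [hση]
    · rw [if_neg hση, if_neg (Ne.symm hση), mul_zero, mul_zero]
  | succ t ih =>
    rw [pow_succ, Matrix.mul_apply, ← pow_succ, pow_succ', Matrix.mul_apply, Finset.mul_sum,
      Finset.mul_sum]
    refine Finset.sum_congr rfl fun y _ => ?_
    rw [← mul_assoc, ih, killed_empty_apply, killed_empty_apply, mul_right_comm,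
      weight_mul_transition_comm, mul_assoc]

/-- By reversibility, the chain is at `η` with probability at most the quotient of the weights. -/
theorem chainLaw_eq_le {N : ℕ} (J : ℕ → ℝ) (h : ℝ) (β : ℝ≥0) (σ η : Config N) (t : ℕ) :
    chainLaw J h β σ {X | X t = η}
      ≤ ENNReal.ofReal (Real.exp (-(β : ℝ) * (energy J h η - energy J h σ))) := by
  have h1 : ∀ a b : Config N, chainLaw J h β a {X | X t = b}
      = ENNReal.ofReal ((killed J h β ∅ ^ t) a b) := by
    intro a b
    rw [← chainLaw_avoid_eq_killed_pow]
    simp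
  have h2 : (killed J h β ∅ ^ t) η σ ≤ 1 := by
    rw [← ENNReal.ofReal_le_one, ← h1]
    exact prob_le_one
  rw [h1]
  refine ENNReal.ofReal_le_ofReal ?_
  have h3 := weight_mul_pow_comm J h β t σ η
  have h4 : weight J h β σ * Real.exp (-(β : ℝ) * (energy J h η - energy J h σ))
      = weight J h β η := by
    rw [weight, weight, ← Real.exp_add]
    congr 1
    ring
  refine le_of_mul_le_mul_left ?_ (weight_pos J h β σ)
  rw [h3, h4]
  exact mul_le_of_le_one_right (weight_pos J h β η).le h2

/-! ### The hitting time as a sum of tail indicators -/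

theorem hittingTime_le_coe_iff {N : ℕ} (η : Config N) (X : ℕ → Config N) (T : ℕ) :
    hittingTime η X ≤ T ↔ ∃ t, 0 < t ∧ t ≤ T ∧ X t = η := by
  constructor
  · intro hle
    by_contra! hcon
    have : ((T + 1 : ℕ) : ℕ∞) ≤ hittingTime η X := by
      refine le_iInf₂ fun t ht => ?_
      by_contra hlt
      rw [Nat.cast_le, not_le] at hlt
      exact hcon t ht.1 (by omega) ht.2
    have h2 := this.trans hle
    rw [Nat.cast_le] at h2
    omega
  · rintro ⟨t, h0, hT, ht⟩
    exact (iInf₂_le t ⟨h0, ht⟩).trans (Nat.cast_le.2 hT)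

/-- The event that `η` is not visited at the times `1, …, t`. -/
def avoids {N : ℕ} (η : Config N) (t : ℕ) : Set (ℕ → Config N) :=
  {X | ∀ s, 0 < s → s ≤ t → X s ≠ η}

theorem measurableSet_avoids {N : ℕ} (η : Config N) (t : ℕ) : MeasurableSet (avoids η t) := by
  simp only [avoids, Set.ofPred_forall]
  exact MeasurableSet.iInter fun s => MeasurableSet.iInter fun _ => MeasurableSet.iInter fun _ =>
    show MeasurableSet ((fun X : ℕ → Config N => X s) ⁻¹' {η}ᶜ) from
      measurable_pi_apply s (measurableSet_singleton η).compl

theorem mem_avoids_iff {N : ℕ} (η : Config N) (t : ℕ) (X : ℕ → Config N) :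
    X ∈ avoids η t ↔ (t : ℕ∞) < hittingTime η X := by
  rw [← not_le, hittingTime_le_coe_iff]
  simp only [avoids, Set.mem_ofPred_eq]
  push Not
  rfl

theorem hittingTime_eq_tsum {N : ℕ} (η : Config N) (X : ℕ → Config N) :
    (hittingTime η X : ℝ≥0∞) = ∑' t, (avoids η t).indicator 1 X := by
  classical
  simp only [Set.indicator_apply, mem_avoids_iff, Pi.one_apply]
  cases hittingTime η X with
  | top => simp
  | coe n =>
    simp only [Nat.cast_lt, ENat.toENNReal_coe]
    rw [tsum_eq_sum (s := Finset.range n) fun b hb => if_neg (by simpa using hb)]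
    rw [Finset.sum_congr rfl fun b hb => if_pos (Finset.mem_range.1 hb)]
    simp

theorem measurable_hittingTime {N : ℕ} (η : Config N) :
    Measurable fun X : ℕ → Config N => (hittingTime η X : ℝ≥0∞) := by
  simp only [hittingTime_eq_tsum]
  exact Measurable.tsum fun t => measurable_one.indicator (measurableSet_avoids η t)

theorem lintegral_hittingTime {N : ℕ} (η : Config N) (P : Measure (ℕ → Config N)) :
    ∫⁻ X, (hittingTime η X : ℝ≥0∞) ∂P = ∑' t, P (avoids η t) := by
  simp only [hittingTime_eq_tsum]
  rw [lintegral_tsum fun t => (measurable_one.indicator (measurableSet_avoids η t)).aemeasurable]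
  exact tsum_congr fun t => lintegral_indicator_one (measurableSet_avoids η t)

/-! ### Dirichlet form and Green function -/

/-- The Dirichlet form of the Metropolis chain, with respect to the unnormalized Gibbs weights. -/
theorem dirichlet_eq {N : ℕ} (J : ℕ → ℝ) (h : ℝ) (β : ℝ≥0) (g : Config N → ℝ) :
    2 * ∑ x, weight J h β x * g x * (g x - ∑ z, transition J h β x z * g z)
      = ∑ x, ∑ z, weight J h β x * transition J h β x z * (g x - g z) ^ 2 := by
  have h1 : ∑ x, ∑ z, weight J h β x * transition J h β x z * g x ^ 2
      = ∑ x, weight J h β x * g x ^ 2 := by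
    refine Finset.sum_congr rfl fun x _ => ?_
    rw [← Finset.sum_mul, ← Finset.mul_sum, sum_transition, mul_one]
  have h2 : ∑ x, ∑ z, weight J h β x * transition J h β x z * g z ^ 2
      = ∑ x, weight J h β x * g x ^ 2 := by
    rw [Finset.sum_comm, ← h1]
    refine Finset.sum_congr rfl fun x _ => Finset.sum_congr rfl fun z _ => ?_
    rw [weight_mul_transition_comm]
  have h3 : ∑ x, ∑ z, weight J h β x * transition J h β x z * (g x - g z) ^ 2
      = ∑ x, ∑ z, weight J h β x * transition J h β x z * g x ^ 2
        + ∑ x, ∑ z, weight J h β x * transition J h β x z * g z ^ 2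
        - 2 * ∑ x, ∑ z, weight J h β x * g x * (transition J h β x z * g z) := by
    rw [Finset.mul_sum, ← Finset.sum_add_distrib, ← Finset.sum_sub_distrib]
    refine Finset.sum_congr rfl fun x _ => ?_
    rw [Finset.mul_sum, ← Finset.sum_add_distrib, ← Finset.sum_sub_distrib]
    exact Finset.sum_congr rfl fun z _ => by ring
  rw [h3, h1, h2, ← two_mul, ← mul_sub, ← Finset.sum_sub_distrib]
  congr 1
  refine Finset.sum_congr rfl fun x _ => ?_
  rw [mul_sub, Finset.mul_sum]
  ring

theorem edge_le_dirichlet {N : ℕ} (J : ℕ → ℝ) (h : ℝ) (β : ℝ≥0) (g : Config N → ℝ)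
    (σ η : Config N) :
    weight J h β σ * transition J h β σ η * (g σ - g η) ^ 2
      ≤ 2 * ∑ x, weight J h β x * g x * (g x - ∑ z, transition J h β x z * g z) := by
  have h0 : ∀ x z, 0 ≤ weight J h β x * transition J h β x z * (g x - g z) ^ 2 := fun x z =>
    mul_nonneg (mul_nonneg (weight_pos J h β x).le (transition_nonneg J h β x z)) (sq_nonneg _)
  rw [dirichlet_eq]
  calc _ ≤ ∑ z, weight J h β σ * transition J h β σ z * (g σ - g z) ^ 2 :=
        Finset.single_le_sum (f := fun z => weight J h β σ * transition J h β σ z * (g σ - g z) ^ 2)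
          (fun z _ => h0 σ z) (Finset.mem_univ η)
    _ ≤ _ := Finset.single_le_sum
          (f := fun x => ∑ z, weight J h β x * transition J h β x z * (g x - g z) ^ 2)
          (fun x _ => Finset.sum_nonneg fun z _ => h0 x z) (Finset.mem_univ σ)

/-- The expected number of visits to `y` before time `n` of the chain killed on leaving `D`. -/
noncomputable def green {N : ℕ} (J : ℕ → ℝ) (h : ℝ) (β : ℝ≥0) (D : Finset (Config N)) (n : ℕ)
    (x y : Config N) : ℝ :=
  ∑ t ∈ Finset.range n, (killed J h β D ^ t) x y

theorem green_nonneg {N : ℕ} (J : ℕ → ℝ) (h : ℝ) (β : ℝ≥0) (D : Finset (Config N)) (n : ℕ)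
    (x y : Config N) : 0 ≤ green J h β D n x y :=
  Finset.sum_nonneg fun t _ => killed_pow_nonneg J h β D t x y

theorem green_le_succ {N : ℕ} (J : ℕ → ℝ) (h : ℝ) (β : ℝ≥0) (D : Finset (Config N)) (n : ℕ)
    (x y : Config N) : green J h β D n x y ≤ green J h β D (n + 1) x y := by
  rw [green, green, Finset.sum_range_succ]
  exact le_add_of_nonneg_right (killed_pow_nonneg J h β D n x y)

theorem green_succ {N : ℕ} (J : ℕ → ℝ) (h : ℝ) (β : ℝ≥0) (D : Finset (Config N)) (n : ℕ)
    (x y : Config N) : green J h β D (n + 1) x y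
      = (if x = y then 1 else 0) + ∑ z, killed J h β D x z * green J h β D n z y := by
  simp only [green, Finset.mul_sum]
  rw [Finset.sum_range_succ', pow_zero, Matrix.one_apply, add_comm, Finset.sum_comm]
  simp only [pow_succ', Matrix.mul_apply]

/-- A chain started elsewhere must first arrive at `y`, and has fewer steps left from then on. The
induction on `n` follows the first step. -/
theorem green_le_diag {N : ℕ} (J : ℕ → ℝ) (h : ℝ) (β : ℝ≥0) (D : Finset (Config N)) (n : ℕ)
    (x y : Config N) : green J h β D n x y ≤ green J h β D n y y := by
  by_cases hxy : x = y
  · rw [hxy]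
  induction n generalizing x with
  | zero => simp [green]
  | succ n ih =>
    refine le_trans ?_ (green_le_succ J h β D n y y)
    rw [green_succ, if_neg hxy, zero_add]
    calc ∑ z, killed J h β D x z * green J h β D n z y
        ≤ ∑ z, killed J h β D x z * green J h β D n y y := by
          refine Finset.sum_le_sum fun z _ =>
            mul_le_mul_of_nonneg_left ?_ (killed_nonneg J h β D x z)
          by_cases hzy : z = y
          · rw [hzy]
          · exact ih z hzy
      _ = (∑ z, killed J h β D x z) * green J h β D n y y := by rw [Finset.sum_mul]
      _ ≤ green J h β D n y y :=
          mul_le_of_le_one_left (green_nonneg J h β D n y y) (sum_killed_le_one J h β D x)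

theorem green_eq_zero {N : ℕ} (J : ℕ → ℝ) (h : ℝ) (β : ℝ≥0) {D : Finset (Config N)} (n : ℕ)
    {x y : Config N} (hx : x ∈ D) (hy : y ∉ D) : green J h β D n x y = 0 := by
  refine Finset.sum_eq_zero fun t _ => ?_
  cases t with
  | zero =>
    rw [pow_zero, Matrix.one_apply, if_neg (ne_of_mem_of_not_mem hx hy)]
  | succ t =>
    rw [pow_succ', Matrix.mul_apply]
    exact Finset.sum_eq_zero fun z _ => by rw [killed, Matrix.of_apply, if_pos hx, zero_mul]

/-- Off `D`, monotonicity in `n` and the first-step equation bound g - Pg by the indicator of `y`;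
on `D` the factor g vanishes. The truncation at `n` thus turns the usual identity into an inequality
and avoids any question of convergence. -/
theorem dirichlet_green_le {N : ℕ} (J : ℕ → ℝ) (h : ℝ) (β : ℝ≥0) {D : Finset (Config N)} (n : ℕ)
    {y : Config N} (hy : y ∉ D) :
    ∑ x, weight J h β x * green J h β D n x y
        * (green J h β D n x y - ∑ z, transition J h β x z * green J h β D n z y)
      ≤ weight J h β y * green J h β D n y y := by
  calc _ ≤ ∑ x, weight J h β x * green J h β D n x y * (if x = y then 1 else 0) := by
        refine Finset.sum_le_sum fun x _ => ?_
        by_cases hx : x ∈ D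
        · rw [green_eq_zero J h β n hx hy]
          simp
        · refine mul_le_mul_of_nonneg_left ?_
            (mul_nonneg (weight_pos J h β x).le (green_nonneg J h β D n x y))
          have h1 := green_le_succ J h β D n x y
          rw [green_succ] at h1
          simp only [killed, Matrix.of_apply, if_neg hx] at h1
          linarith
    _ = _ := by simp

/-- Every configuration is visited at most about `exp (β Γ)` times before the chain reaches the
all-plus configuration. -/
theorem green_diag_le {N : ℕ} (hN : 0 < N) {J : ℕ → ℝ} (hJ_pos : ∀ n, 1 ≤ n → 0 < J n)
    (hJ_anti : AntitoneOn J (Set.Ici 1)) (h : ℝ) (β : ℝ≥0) (n : ℕ) {y : Config N}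
    (hy : y ≠ allPlus N) :
    green J h β {allPlus N} n y y ≤ 2 * (N : ℝ) ^ 3 * Real.exp (β * barrier N J h) := by
  have hyD : y ∉ ({allPlus N} : Finset (Config N)) := by simpa using hy
  set g : Config N → ℝ := fun x => green J h β {allPlus N} n x y with hg
  change g y ≤ _
  have hN' : (0 : ℝ) < N := Nat.cast_pos.2 hN
  rcases (green_nonneg J h β {allPlus N} n y y).eq_or_lt with h0 | hpos
  · change 0 = g y at h0
    rw [← h0]
    positivity
  change 0 < g y at hpos
  -- Pigeonhole on the filling path from `y` to all plus: the `N` increments add up to the whole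
  -- drop from `g y` to 0.
  obtain ⟨k, hk, hgk⟩ : ∃ k ∈ Finset.range N,
      g y / N ≤ g (fillLeft y k) - g (fillLeft y (k + 1)) := by
    refine Finset.exists_le_of_sum_le (by simpa using hN.ne') ?_
    rw [Finset.sum_range_sub' (fun k => g (fillLeft y k)), fillLeft_zero, fillLeft_self,
      Finset.sum_const, Finset.card_range, nsmul_eq_mul, mul_div_cancel₀ _ hN'.ne']
    have : g (allPlus N) = 0 := green_eq_zero J h β n (by simp) hyD
    rw [this, sub_zero]
  have hkN := Finset.mem_range.1 hk
  have hdiff : 0 < g y / N := div_pos hpos hN'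
  -- A strictly positive drop excludes the idle steps, at which the spin is already plus.
  have hne : fillLeft y (k + 1) ≠ fillLeft y k := by
    intro heq
    rw [heq, sub_self] at hgk
    linarith
  have hham := (fillLeft_succ y k).resolve_left hne
  have hw : weight J h β y * Real.exp (-(β : ℝ) * barrier N J h) / N
      ≤ weight J h β (fillLeft y k) * transition J h β (fillLeft y k) (fillLeft y (k + 1)) := by
    rw [transition, if_neg hne, weight_mul_flipRate, connectivity, if_pos hham, weight,
      ← Real.exp_add, ← mul_add, one_div, div_eq_inv_mul]
    have hmax := max_le (energy_fillLeft_le hJ_pos hJ_anti h y hkN.le)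
      (energy_fillLeft_le hJ_pos hJ_anti h y (show k + 1 ≤ N from hkN))
    have := mul_le_mul_of_nonneg_left hmax β.2
    gcongr ?_ * Real.exp ?_
    rw [neg_mul, neg_mul]
    exact neg_le_neg this
  have h1 := edge_le_dirichlet J h β g (fillLeft y k) (fillLeft y (k + 1))
  have h2 := dirichlet_green_le J h β n hyD
  have h3 : weight J h β y * Real.exp (-(β : ℝ) * barrier N J h) / N * (g y / N) ^ 2
      ≤ 2 * (weight J h β y * g y) := by
    refine le_trans ?_ (h1.trans (mul_le_mul_of_nonneg_left h2 zero_le_two))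
    exact mul_le_mul hw (pow_le_pow_left₀ hdiff.le hgk 2) (sq_nonneg _)
      ((by have := weight_pos J h β y; positivity : (0 : ℝ) ≤ _).trans hw)
  have hwy := weight_pos J h β y
  have h4 : Real.exp (-(β : ℝ) * barrier N J h) * g y ≤ 2 * (N : ℝ) ^ 3 := by
    refine le_of_mul_le_mul_left ?_ (show 0 < weight J h β y * g y / (N : ℝ) ^ 3 by positivity)
    calc _ = weight J h β y * Real.exp (-(β : ℝ) * barrier N J h) / N * (g y / N) ^ 2 := by
          field_simp
      _ ≤ _ := h3
      _ = _ := by field_simp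
  calc g y = Real.exp (-(β : ℝ) * barrier N J h) * g y * Real.exp (β * barrier N J h) := by
        rw [mul_right_comm, ← Real.exp_add, neg_mul, neg_add_cancel, Real.exp_zero, one_mul]
    _ ≤ _ := mul_le_mul_of_nonneg_right h4 (Real.exp_pos _).le

/-! ### Upper bound on the mean hitting time -/

theorem chainLaw_avoids_le {N : ℕ} (J : ℕ → ℝ) (h : ℝ) (β : ℝ≥0) {σ η : Config N} (hση : σ ≠ η)
    (t : ℕ) : chainLaw J h β σ (avoids η t)
      ≤ ∑ z ∈ Finset.univ.erase η, ENNReal.ofReal ((killed J h β {η} ^ t) σ z) := by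
  -- `avoids` says nothing about time 0, whereas the killed chain also excludes it; the difference
  -- is a null event since the chain starts at `σ ≠ η`.
  have hsub : avoids η t ⊆ {X | X 0 = η} ∪
      ⋃ z ∈ Finset.univ.erase η, {X | (∀ s < t, X s ∉ ({η} : Finset (Config N))) ∧ X t = z} := by
    intro X hX
    by_cases h0 : X 0 = η
    · exact Or.inl h0
    · have hne : ∀ s ≤ t, X s ≠ η := by
        intro s hs
        rcases Nat.eq_zero_or_pos s with rfl | hs0
        · exact h0
        · exact hX s hs0 hs
      refine Or.inr (Set.mem_iUnion₂.2 ⟨X t, ?_, fun s hs => ?_, rfl⟩)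
      · simpa using hne t le_rfl
      · simpa using hne s hs.le
  refine (measure_mono hsub).trans ((measure_union_le _ _).trans ?_)
  rw [chainLaw_zero, if_neg hση, zero_add]
  refine (measure_biUnion_finset_le _ _).trans (Finset.sum_le_sum fun z _ => ?_)
  rw [chainLaw_avoid_eq_killed_pow]

/-- The mean time to reach the all-plus configuration is at most of order `exp (β Γ)`. -/
theorem lintegral_hittingTime_le {N : ℕ} (hN : 0 < N) {J : ℕ → ℝ}
    (hJ_pos : ∀ n, 1 ≤ n → 0 < J n) (hJ_anti : AntitoneOn J (Set.Ici 1)) (h : ℝ) (β : ℝ≥0)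
    {σ : Config N} (hσ : σ ≠ allPlus N) :
    ∫⁻ X, (hittingTime (allPlus N) X : ℝ≥0∞) ∂(chainLaw J h β σ)
      ≤ ENNReal.ofReal
        (Fintype.card (Config N) * (2 * (N : ℝ) ^ 3) * Real.exp (β * barrier N J h)) := by
  rw [lintegral_hittingTime]
  refine ENNReal.tsum_le_of_sum_range_le fun n => ?_
  calc ∑ t ∈ Finset.range n, chainLaw J h β σ (avoids (allPlus N) t)
      ≤ ∑ t ∈ Finset.range n, ∑ z ∈ Finset.univ.erase (allPlus N),
          ENNReal.ofReal ((killed J h β {allPlus N} ^ t) σ z) :=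
        Finset.sum_le_sum fun t _ => chainLaw_avoids_le J h β hσ t
    _ = ∑ z ∈ Finset.univ.erase (allPlus N), ENNReal.ofReal (green J h β {allPlus N} n σ z) := by
        rw [Finset.sum_comm]
        refine Finset.sum_congr rfl fun z _ => ?_
        rw [green, ENNReal.ofReal_sum_of_nonneg fun t _ => killed_pow_nonneg J h β _ t σ z]
    _ ≤ ∑ z ∈ Finset.univ.erase (allPlus N),
          ENNReal.ofReal (2 * (N : ℝ) ^ 3 * Real.exp (β * barrier N J h)) :=
        Finset.sum_le_sum fun z hz => ENNReal.ofReal_le_ofReal <|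
          (green_le_diag J h β _ n σ z).trans
            (green_diag_le hN hJ_pos hJ_anti h β n (Finset.ne_of_mem_erase hz))
    _ ≤ ∑ z : Config N, ENNReal.ofReal (2 * (N : ℝ) ^ 3 * Real.exp (β * barrier N J h)) :=
        Finset.sum_le_sum_of_subset (Finset.erase_subset _ _)
    _ = _ := by
        rw [Finset.sum_const, Finset.card_univ, nsmul_eq_mul, mul_assoc (Fintype.card (Config N) : ℝ),
          ENNReal.ofReal_mul (Nat.cast_nonneg _), ENNReal.ofReal_natCast]

/-! ### Lower bound: crossing the critical level -/

theorem plusSet_allMinus (N : ℕ) : plusSet (allMinus N) = ∅ := by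
  rw [allMinus_eq_leftDroplet, plusSet_leftDroplet (Nat.zero_le N), Finset.range_zero]

theorem plusSet_allPlus (N : ℕ) : plusSet (allPlus N) = Finset.range N := by
  rw [allPlus_eq_leftDroplet, plusSet_leftDroplet le_rfl]

theorem allMinus_ne_allPlus {N : ℕ} (hN : 0 < N) : allMinus N ≠ allPlus N := by
  intro heq
  have := congrArg (fun σ => (plusSet σ).card) heq
  simp only [plusSet_allMinus, plusSet_allPlus, Finset.card_empty, Finset.card_range] at this
  omega

/-- The configurations with exactly `k` plus spins. -/
def level (N k : ℕ) : Finset (Config N) := Finset.univ.filter fun σ => (plusSet σ).card = k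

theorem mem_level {N k : ℕ} (σ : Config N) : σ ∈ level N k ↔ (plusSet σ).card = k := by
  simp [level]

/-- The chain started at all-minus cannot exceed `k` plus spins before having exactly `k`. -/
theorem killed_level_pow_eq_zero {N k : ℕ} (J : ℕ → ℝ) (h : ℝ) (β : ℝ≥0) (t : ℕ) {z : Config N}
    (hz : k < (plusSet z).card) : (killed J h β (level N k) ^ t) (allMinus N) z = 0 := by
  induction t generalizing z with
  | zero =>
    rw [pow_zero, Matrix.one_apply, if_neg]
    rintro rfl
    simp [plusSet_allMinus] at hz
  | succ t ih =>
    rw [pow_succ, Matrix.mul_apply]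
    refine Finset.sum_eq_zero fun x _ => ?_
    -- The last step can start neither above level `k`, by induction, nor on it, where the row is
    -- zero; from below, a single flip cannot skip the level.
    rcases lt_or_ge k (plusSet x).card with hx | hx
    · rw [ih hx, zero_mul]
    · rw [killed, Matrix.of_apply]
      split_ifs with hxk
      · rw [mul_zero]
      · rw [mem_level] at hxk
        have hzx : z ≠ x := by
          rintro rfl
          omega
        have := card_plusSet_le_add_hammingDist x z
        rw [transition, if_neg hzx, flipRate, connectivity, if_neg (by omega), zero_mul, mul_zero]

/-- The chain does not reach the all-plus configuration much before time `exp (β Γ)`. -/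
theorem chainLaw_hittingTime_le {N : ℕ} {J : ℕ → ℝ} (hJ_anti : AntitoneOn J (Set.Ici 1)) (h : ℝ)
    (β : ℝ≥0) (T : ℕ) :
    chainLaw J h β (allMinus N) {X | hittingTime (allPlus N) X ≤ T}
      ≤ ENNReal.ofReal
        ((T + 1) * Fintype.card (Config N) * Real.exp (-(β : ℝ) * barrier N J h)) := by
  obtain ⟨k, hk, hkb⟩ := exists_energy_leftDroplet_eq N J h
  set P := chainLaw J h β (allMinus N) with hP
  -- Either the level `k` is visited by time `T`, or all plus is reached without it. The clause
  -- `allPlus N ∉ level N k` means `k ≠ N`, so that the second event is null.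
  have hsub : {X | hittingTime (allPlus N) X ≤ T} ⊆
      (⋃ s ∈ Finset.range (T + 1), ⋃ η ∈ level N k, {X : ℕ → Config N | X s = η}) ∪
      ⋃ s ∈ Finset.range (T + 1),
        {X | ((∀ r < s, X r ∉ level N k) ∧ X s = allPlus N) ∧ allPlus N ∉ level N k} := by
    intro X hX
    obtain ⟨t, -, htT, ht⟩ := (hittingTime_le_coe_iff _ X T).1 hX
    by_cases hv : ∃ s ≤ T, X s ∈ level N k
    · obtain ⟨s, hs, hsk⟩ := hv
      refine Or.inl (Set.mem_iUnion₂.2 ⟨s, by simpa [Nat.lt_succ_iff] using hs, ?_⟩)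
      exact Set.mem_iUnion₂.2 ⟨X s, hsk, rfl⟩
    · push Not at hv
      refine Or.inr (Set.mem_iUnion₂.2 ⟨t, by simpa [Nat.lt_succ_iff] using htT, ?_⟩)
      exact ⟨⟨fun r hr => hv r (by omega), ht⟩, ht ▸ hv t htT⟩
  have h2 : ∀ s, P {X | ((∀ r < s, X r ∉ level N k) ∧ X s = allPlus N) ∧
      allPlus N ∉ level N k} = 0 := by
    intro s
    by_cases hl : allPlus N ∈ level N k
    · simp [hl]
    · simp only [hl, not_false_eq_true, and_true]
      rw [hP, chainLaw_avoid_eq_killed_pow, killed_level_pow_eq_zero, ENNReal.ofReal_zero]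
      rw [mem_level, plusSet_allPlus, Finset.card_range] at hl
      rw [plusSet_allPlus, Finset.card_range]
      omega
  have h1 : ∀ s, ∀ η ∈ level N k, P {X | X s = η}
      ≤ ENNReal.ofReal (Real.exp (-(β : ℝ) * barrier N J h)) := by
    intro s η hη
    refine (chainLaw_eq_le J h β _ η s).trans (ENNReal.ofReal_le_ofReal (Real.exp_le_exp.2 ?_))
    have hmin := energy_leftDroplet_le hJ_anti h η
    rw [(mem_level η).1 hη] at hmin
    have := mul_le_mul_of_nonneg_left
      (show barrier N J h ≤ energy J h η - energy J h (allMinus N) by linarith) β.2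
    rw [neg_mul, neg_mul]
    exact neg_le_neg this
  calc P {X | hittingTime (allPlus N) X ≤ T}
      ≤ ∑ s ∈ Finset.range (T + 1), ∑ η ∈ level N k,
          ENNReal.ofReal (Real.exp (-(β : ℝ) * barrier N J h))
        + ∑ s ∈ Finset.range (T + 1), 0 := by
        refine (measure_mono hsub).trans ((measure_union_le _ _).trans (add_le_add ?_ ?_))
        · exact (measure_biUnion_finset_le _ _).trans <| Finset.sum_le_sum fun s _ =>
            (measure_biUnion_finset_le _ _).trans <| Finset.sum_le_sum fun η hη => h1 s η hη
        · exact (measure_biUnion_finset_le _ _).trans <| Finset.sum_le_sum fun s _ => (h2 s).le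
    _ = (T + 1 : ℕ) * ((level N k).card
          * ENNReal.ofReal (Real.exp (-(β : ℝ) * barrier N J h))) := by
        simp
    _ ≤ (T + 1 : ℕ) * (Fintype.card (Config N)
          * ENNReal.ofReal (Real.exp (-(β : ℝ) * barrier N J h))) := by
        gcongr
        exact Finset.card_le_univ _
    _ = _ := by
        rw [mul_assoc, ENNReal.ofReal_mul (by positivity), ENNReal.ofReal_mul (by positivity),
          ENNReal.ofReal_natCast, ← Nat.cast_succ, ENNReal.ofReal_natCast]

/-! ### Asymptotics as β tends to infinity -/

/-- The time horizon is ⌊exp(β(Γ-ε))⌋. The second exponential comes from the extra 1 in `T + 1`, the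
visit at time 0; it vanishes in the limit when Γ is positive. -/
theorem chainLaw_hittingTime_le_exp {N : ℕ} {J : ℕ → ℝ} (hJ_anti : AntitoneOn J (Set.Ici 1))
    (h ε : ℝ) (β : ℝ≥0) :
    chainLaw J h β (allMinus N)
        {X | (hittingTime (allPlus N) X : ℝ≥0∞)
          ≤ ENNReal.ofReal (Real.exp (β * (barrier N J h - ε)))}
      ≤ ENNReal.ofReal (Fintype.card (Config N) *
        (Real.exp (-(β * ε)) + Real.exp (-(β * barrier N J h)))) := by
  set a := Real.exp (β * (barrier N J h - ε)) with ha
  have ha0 : 0 ≤ a := (Real.exp_pos _).le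
  have hsub : {X : ℕ → Config N | (hittingTime (allPlus N) X : ℝ≥0∞) ≤ ENNReal.ofReal a}
      ⊆ {X | hittingTime (allPlus N) X ≤ (⌊a⌋₊ : ℕ)} := by
    intro X hX
    change (hittingTime (allPlus N) X : ℝ≥0∞) ≤ ENNReal.ofReal a at hX
    change hittingTime (allPlus N) X ≤ (⌊a⌋₊ : ℕ)
    cases hτ : hittingTime (allPlus N) X with
    | top => simp [hτ] at hX
    | coe n =>
      rw [hτ, ENat.toENNReal_coe, ← ENNReal.ofReal_natCast, ENNReal.ofReal_le_ofReal_iff ha0] at hX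
      exact Nat.cast_le.2 (Nat.le_floor hX)
  refine (measure_mono hsub).trans ((chainLaw_hittingTime_le hJ_anti h β _).trans
    (ENNReal.ofReal_le_ofReal ?_))
  calc ((⌊a⌋₊ : ℝ) + 1) * Fintype.card (Config N) * Real.exp (-(β : ℝ) * barrier N J h)
      ≤ (a + 1) * Fintype.card (Config N) * Real.exp (-(β : ℝ) * barrier N J h) := by
        gcongr
        exact Nat.floor_le ha0
    _ = Fintype.card (Config N) * (a * Real.exp (-(β : ℝ) * barrier N J h)
          + Real.exp (-(β : ℝ) * barrier N J h)) := by ring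
    _ = _ := by
        rw [ha, ← Real.exp_add]
        congr 3 <;> ring_nf

theorem chainLaw_exp_le_hittingTime {N : ℕ} (hN : 0 < N) {J : ℕ → ℝ}
    (hJ_pos : ∀ n, 1 ≤ n → 0 < J n) (hJ_anti : AntitoneOn J (Set.Ici 1)) (h ε : ℝ) (β : ℝ≥0) :
    chainLaw J h β (allMinus N)
        {X | ENNReal.ofReal (Real.exp (β * (barrier N J h + ε)))
          ≤ (hittingTime (allPlus N) X : ℝ≥0∞)}
      ≤ ENNReal.ofReal (Fintype.card (Config N) * (2 * (N : ℝ) ^ 3) * Real.exp (-(β * ε))) := by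
  have hpos := Real.exp_pos (β * (barrier N J h + ε))
  refine (meas_ge_le_lintegral_div (measurable_hittingTime (allPlus N)).aemeasurable
    (ENNReal.ofReal_pos.2 hpos).ne' ENNReal.ofReal_ne_top).trans ?_
  refine ENNReal.div_le_of_le_mul ((lintegral_hittingTime_le hN hJ_pos hJ_anti h β
    (allMinus_ne_allPlus hN)).trans_eq ?_)
  rw [← ENNReal.ofReal_mul (by positivity), mul_assoc _ (Real.exp _) (Real.exp _), ← Real.exp_add]
  ring_nf

theorem tendsto_exp_neg_mul {c : ℝ} (hc : 0 < c) :
    Tendsto (fun β : ℝ≥0 => Real.exp (-(β * c))) atTop (𝓝 0) :=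
  Real.tendsto_exp_neg_atTop_nhds_zero.comp
    ((NNReal.tendsto_coe_atTop.2 tendsto_id).atTop_mul_const hc)

theorem tendsto_chainLaw_hittingTime {N : ℕ} (hN : 0 < N) {J : ℕ → ℝ}
    (hJ_pos : ∀ n, 1 ≤ n → 0 < J n) (hJ_anti : AntitoneOn J (Set.Ici 1)) {h : ℝ}
    (hb : 0 < barrier N J h) {ε : ℝ} (hε : 0 < ε) :
    Tendsto
      (fun β : ℝ≥0 => chainLaw J h β (allMinus N)
        {X | ENNReal.ofReal (Real.exp (β * (barrier N J h - ε)))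
              < (hittingTime (allPlus N) X : ℝ≥0∞) ∧
            (hittingTime (allPlus N) X : ℝ≥0∞)
              < ENNReal.ofReal (Real.exp (β * (barrier N J h + ε)))})
      atTop (𝓝 1) := by
  set C : ℝ := (Fintype.card (Config N) : ℝ) with hC
  have hlim : Tendsto (fun β : ℝ≥0 =>
      1 - (ENNReal.ofReal (C * (Real.exp (-(β * ε)) + Real.exp (-(β * barrier N J h))))
        + ENNReal.ofReal (C * (2 * (N : ℝ) ^ 3) * Real.exp (-(β * ε))))) atTop (𝓝 1) := by
    have h1 := ((tendsto_exp_neg_mul hε).add (tendsto_exp_neg_mul hb)).const_mul C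
    have h2 := (tendsto_exp_neg_mul hε).const_mul (C * (2 * (N : ℝ) ^ 3))
    have h3 := ENNReal.Tendsto.sub (tendsto_const_nhds (x := (1 : ℝ≥0∞)) (f := atTop))
      ((ENNReal.tendsto_ofReal h1).add (ENNReal.tendsto_ofReal h2)) (Or.inl ENNReal.one_ne_top)
    simpa using h3
  refine tendsto_of_tendsto_of_tendsto_of_le_of_le hlim tendsto_const_nhds (fun β => ?_)
    fun β => prob_le_one
  rw [tsub_le_iff_right]
  have hcover : (Set.univ : Set (ℕ → Config N)) ⊆
      {X | ENNReal.ofReal (Real.exp (β * (barrier N J h - ε)))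
              < (hittingTime (allPlus N) X : ℝ≥0∞) ∧
            (hittingTime (allPlus N) X : ℝ≥0∞)
              < ENNReal.ofReal (Real.exp (β * (barrier N J h + ε)))} ∪
      ({X | (hittingTime (allPlus N) X : ℝ≥0∞)
          ≤ ENNReal.ofReal (Real.exp (β * (barrier N J h - ε)))} ∪
      {X | ENNReal.ofReal (Real.exp (β * (barrier N J h + ε)))
          ≤ (hittingTime (allPlus N) X : ℝ≥0∞)}) := by
    intro X _
    simp only [Set.mem_union, Set.mem_ofPred_eq]
    rcases lt_or_ge (ENNReal.ofReal (Real.exp (β * (barrier N J h - ε))))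
      (hittingTime (allPlus N) X : ℝ≥0∞) with h1 | h1
    · rcases lt_or_ge (hittingTime (allPlus N) X : ℝ≥0∞)
        (ENNReal.ofReal (Real.exp (β * (barrier N J h + ε)))) with h2 | h2
      · exact Or.inl ⟨h1, h2⟩
      · exact Or.inr (Or.inr h2)
    · exact Or.inr (Or.inl h1)
  rw [← measure_univ (μ := chainLaw J h β (allMinus N))]
  refine (measure_mono hcover).trans ((measure_union_le _ _).trans ?_)
  gcongr
  refine (measure_union_le _ _).trans (add_le_add ?_ ?_)
  · exact chainLaw_hittingTime_le_exp hJ_anti h ε β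
  · exact chainLaw_exp_le_hittingTime hN hJ_pos hJ_anti h ε β

theorem tendsto_log_lintegral_hittingTime {N : ℕ} (hN : 0 < N) {J : ℕ → ℝ}
    (hJ_pos : ∀ n, 1 ≤ n → 0 < J n) (hJ_anti : AntitoneOn J (Set.Ici 1)) {h : ℝ}
    (hb : 0 < barrier N J h) :
    Tendsto
      (fun β : ℝ≥0 => 1 / (β : ℝ) * Real.log
        (∫⁻ X, (hittingTime (allPlus N) X : ℝ≥0∞) ∂(chainLaw J h β (allMinus N))).toReal)
      atTop (𝓝 (barrier N J h)) := by
  set E : ℝ≥0 → ℝ≥0∞ := fun β =>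
    ∫⁻ X, (hittingTime (allPlus N) X : ℝ≥0∞) ∂(chainLaw J h β (allMinus N)) with hE
  change Tendsto (fun β : ℝ≥0 => 1 / (β : ℝ) * Real.log (E β).toReal) atTop _
  set C : ℝ := Fintype.card (Config N) * (2 * (N : ℝ) ^ 3) with hC
  have hC0 : 0 < C := by
    have : 0 < Fintype.card (Config N) := Fintype.card_pos
    positivity
  have hupper : ∀ β, E β ≤ ENNReal.ofReal (C * Real.exp (β * barrier N J h)) := fun β =>
    lintegral_hittingTime_le hN hJ_pos hJ_anti h β (allMinus_ne_allPlus hN)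
  have hfin : ∀ β, E β ≠ ⊤ := fun β => ((hupper β).trans_lt ENNReal.ofReal_lt_top).ne
  -- Markov's inequality read backwards: τ exceeds exp(β(Γ-ε)) with probability at least 1/2 once β
  -- is large.
  have hlower : ∀ ε, 0 < ε → ∀ᶠ β : ℝ≥0 in atTop,
      Real.exp (β * (barrier N J h - ε)) * (1 / 2) ≤ (E β).toReal := by
    intro ε hε
    filter_upwards [(tendsto_order.1 (tendsto_chainLaw_hittingTime hN hJ_pos hJ_anti hb hε)).1
      (ENNReal.ofReal (1 / 2)) (by rw [ENNReal.ofReal_lt_one]; norm_num)] with β hβ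
    rw [← ENNReal.ofReal_le_iff_le_toReal (hfin β), ENNReal.ofReal_mul (Real.exp_pos _).le]
    refine le_trans ?_ (mul_meas_ge_le_lintegral (measurable_hittingTime (allPlus N))
      (ENNReal.ofReal (Real.exp (β * (barrier N J h - ε)))))
    gcongr
    refine hβ.le.trans (measure_mono fun X hX => hX.1.le)
  have hdiv : ∀ c : ℝ, Tendsto (fun β : ℝ≥0 => c / (β : ℝ)) atTop (𝓝 0) := fun c =>
    (NNReal.tendsto_coe_atTop.2 tendsto_id).const_div_atTop c
  have hpos : ∀ᶠ β : ℝ≥0 in atTop, (0 : ℝ) < β :=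
    (eventually_gt_atTop 0).mono fun β hβ => NNReal.coe_pos.2 hβ
  rw [tendsto_order]
  constructor
  · intro a ha
    -- Half of the gap is spent on the exponent, half on absorbing log(1/2)/β.
    have hε : 0 < (barrier N J h - a) / 2 := by linarith
    filter_upwards [hpos, hlower _ hε, (tendsto_order.1 (hdiv (Real.log (1 / 2)))).1
      (-((barrier N J h - a) / 2)) (by linarith)] with β hβ h1 h2
    have h3 := Real.log_le_log (by positivity) h1
    rw [Real.log_mul (Real.exp_pos _).ne' (by norm_num), Real.log_exp] at h3
    have h4 := div_le_div_of_nonneg_right h3 hβ.le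
    rw [add_div, mul_div_cancel_left₀ _ hβ.ne'] at h4
    rw [one_div_mul_eq_div]
    linarith
  · intro a ha
    -- The lower bound, with an arbitrary ε = 1, only serves to make the mean positive, as
    -- monotonicity of the logarithm requires.
    filter_upwards [hpos, hlower 1 one_pos, (tendsto_order.1 (hdiv (Real.log C))).2
      (a - barrier N J h) (by linarith)] with β hβ h1 h2
    have h0 : 0 < (E β).toReal := lt_of_lt_of_le (by positivity) h1
    have h3 := Real.log_le_log h0 (ENNReal.toReal_le_of_le_ofReal (by positivity) (hupper β))
    rw [Real.log_mul hC0.ne' (Real.exp_pos _).ne', Real.log_exp] at h3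
    have h4 := div_le_div_of_nonneg_right h3 hβ.le
    rw [add_div, mul_div_cancel_left₀ _ hβ.ne'] at h4
    rw [one_div_mul_eq_div]
    linarith

end LongRangeIsing

theorem theorem3p3 (N : ℕ) (hN : 2 ≤ N) (J : ℕ → ℝ) (hJ_pos : ∀ n, 1 ≤ n → 0 < J n)
    (hJ_anti : AntitoneOn J (Set.Ici 1)) (h : ℝ) (h_pos : 0 < h)
    (h_lt : h < ∑ n ∈ Finset.Icc 1 (N - 1), J n) :
    (∀ ε : ℝ, 0 < ε →
      Tendsto
        (fun β : ℝ≥0 => LongRangeIsing.chainLaw J h β (LongRangeIsing.allMinus N)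
          {X | ENNReal.ofReal (Real.exp (β * (LongRangeIsing.barrier N J h - ε)))
                < (LongRangeIsing.hittingTime (LongRangeIsing.allPlus N) X : ℝ≥0∞) ∧
              (LongRangeIsing.hittingTime (LongRangeIsing.allPlus N) X : ℝ≥0∞)
                < ENNReal.ofReal (Real.exp (β * (LongRangeIsing.barrier N J h + ε)))})
        atTop (𝓝 1)) ∧
    (∀ β : ℝ≥0, 0 < β →
      ∫⁻ X, (LongRangeIsing.hittingTime (LongRangeIsing.allPlus N) X : ℝ≥0∞)
        ∂(LongRangeIsing.chainLaw J h β (LongRangeIsing.allMinus N)) ≠ ⊤) ∧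
    Tendsto
      (fun β : ℝ≥0 => 1 / (β : ℝ) * Real.log
        (∫⁻ X, (LongRangeIsing.hittingTime (LongRangeIsing.allPlus N) X : ℝ≥0∞)
          ∂(LongRangeIsing.chainLaw J h β (LongRangeIsing.allMinus N))).toReal)
      atTop (𝓝 (LongRangeIsing.barrier N J h)) := by
  have hN0 : 0 < N := by omega
  have hb := LongRangeIsing.barrier_pos hN h_lt
  refine ⟨fun ε hε => LongRangeIsing.tendsto_chainLaw_hittingTime hN0 hJ_pos hJ_anti hb hε,
    fun β _ => ?_, LongRangeIsing.tendsto_log_lintegral_hittingTime hN0 hJ_pos hJ_anti hb⟩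
  exact ((LongRangeIsing.lintegral_hittingTime_le hN0 hJ_pos hJ_anti h β
    (LongRangeIsing.allMinus_ne_allPlus hN0)).trans_lt ENNReal.ofReal_lt_top).ne
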